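/- **Notation.** Let $d\ge 1$, $1\le a<b\le\infty$, let $m$ be Lebesgue measure on $\mathbb R^d$ and $|f|_p=(\int|f|^p\,dm)^{1/p}$. A weight is a continuous function $\psi:(a,b)\to(0,\infty)$ (no condition on its behaviour at the end points). For a weight $\psi$, $G(\psi)$ is the space of measurable $f$ on $\mathbb R^d$ with $\|f\|G(\psi)=\sup_{p\in(a,b)}|f|_p/\psi(p)<\infty$, and $G^o(\psi)$ is the subspace of those $f\in G(\psi)$ with $|f|_p/\psi(p)\to0$ as $\psi(p)\to\infty$, $p\in(a,b)$ (same norm). For weights $\psi,\nu$ write $\nu\gg\psi$ if $\psi(p)/\nu(p)\to0$ as $\nu(p)\to\infty$, $p\in(a,b)$. A Schwarz symmetrization $u^*$ of a measurable $u:\mathbb R^d\to[0,\infty]$ is a function such that for every $\lambda\ge0$ the set $\{u^*>\lambda\}$ is an open ball $B(0,r)$, $0\le r\le\infty$, and $m\{u^*>\lambda\}=m\{u>\lambda\}$. For a closed half-space $H\subset\mathbb R^d$ with boundary reflection $\sigma_H$, the polarization $u^H$ is $\max(u,u\circ\sigma_H)$ on $H$ and $\min(u,u\circ\sigma_H)$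 outside $H$; $u^{H_0H_1\cdots H_k}$ denotes successive polarization, first by $H_0$. Let $(H_k)_{k\ge0}$ be a sequence that is dense in the space of closed half-spaces containing the origin in their interior (parametrized as $\{x:\langle x,e\rangle\le t\}$, $|e|=1$, $t>0$), and let $u_0=u$, $u_{n+1}=u_n^{H_0H_1\cdots H_n}$ be van Schaftingen's polarization iterates. **Theorem 3.** Let $u:\mathbb R^d\to[0,\infty]$ be measurable with $u\in G(\psi)$, let $u^*$ be a Schwarz symmetrization of $u$ and $(u_n)$ the polarization iterates of $u$. 1. For every weight $\nu$ on $(a,b)$ with $\nu\gg\psi$ and $\sup_{p\in(a,b)}\psi(p)/\nu(p)<\infty$ (so that $G(\nu)$ carries the weaker norm), and, if $b=\infty$, with $\nu(p)\to\infty$ as $p\to\infty$, all $|u_n-u^*|$ belong to $G(\nu)$ and $\|u_n-u^*\|G(\nu)\to0$ as $n\to\infty$. 2. If in addition $u\in G^o(\psi)$ and, if $b=\infty$, $\psi(p)\to\infty$ as $p\to\infty$, then all $|u_n-u^*|$ belong to $G^o(\psi)$ and $\|u_n-u^*\|G^o(\psi)=\|u_n-u^*\|G(\psi)\to0$ as $n\to\infty$.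 -/

import Mathlib

open MeasureTheory Set Filter Topology
open scoped ENNReal NNReal

/-! ### Bilateral grand Lebesgue spaces -/

/-- The open interval `(a, b)` of exponents, where `b` may be `+∞`. -/
def expInterval (a : ℝ) (b : EReal) : Set ℝ := {p : ℝ | a < p ∧ (p : EReal) < b}

/-- Weight functions: strictly positive and continuous on the open interval `(a, b)`.
Only the values on the open interval enter the norm, so nothing is asked at the end points;
in particular the one-sided limits there may be finite or infinite. -/
structure IsWeight (a : ℝ) (b : EReal) (ψ : ℝ → ℝ) : Prop where
  pos : ∀ p ∈ expInterval a b, 0 < ψ p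
  cont : ContinuousOn ψ (expInterval a b)

section BGLS

variable {X : Type*} [MeasurableSpace X] {ε : Type*} [ENorm ε]

/-- The quotient `|f|_p / ψ(p)`, with values in `[0, ∞]`. -/
noncomputable def gQuot (μ : Measure X) (ψ : ℝ → ℝ) (f : X → ε) (p : ℝ) : ℝ≥0∞ :=
  eLpNorm f (ENNReal.ofReal p) μ / ENNReal.ofReal (ψ p)

/-- The norm `‖f‖G(ψ) = sup_{p ∈ (a, b)} |f|_p / ψ(p)`, with values in `[0, ∞]`. -/
noncomputable def gNorm (μ : Measure X) (a : ℝ) (b : EReal) (ψ : ℝ → ℝ) (f : X → ε) : ℝ≥0∞ :=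
  ⨆ p ∈ expInterval a b, gQuot μ ψ f p

/-- The filter describing `ψ(p) → ∞`, `p ∈ (a, b)`. -/
def weightFilter (a : ℝ) (b : EReal) (ψ : ℝ → ℝ) : Filter ℝ :=
  comap ψ atTop ⊓ 𝓟 (expInterval a b)

/-- `f ∈ G(ψ)`: `f` is measurable and has finite norm. -/
def MemG [MeasurableSpace ε] (μ : Measure X) (a : ℝ) (b : EReal) (ψ : ℝ → ℝ) (f : X → ε) : Prop :=
  Measurable f ∧ gNorm μ a b ψ f < ∞

/-- `f ∈ Gᵒ(ψ)`: `f ∈ G(ψ)` and `|f|_p / ψ(p) → 0` as `ψ(p) → ∞`. -/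
def MemGo [MeasurableSpace ε] (μ : Measure X) (a : ℝ) (b : EReal) (ψ : ℝ → ℝ) (f : X → ε) : Prop :=
  MemG μ a b ψ f ∧ Tendsto (gQuot μ ψ f) (weightFilter a b ψ) (𝓝 0)

end BGLS

/-- `ν ≫ ψ`, that is, `ψ(p) / ν(p) → 0` as `ν(p) → ∞`, `p ∈ (a, b)`. -/
def MuchGreater (a : ℝ) (b : EReal) (ν ψ : ℝ → ℝ) : Prop :=
  Tendsto (fun p => ψ p / ν p) (weightFilter a b ν) (𝓝 0)

/-! ### Symmetrization and polarization in Euclidean space -/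

/-- `v` is a Schwarz symmetrization of `u`: every superlevel set of `v` is an open ball around the
origin (of radius in `[0, ∞]`, so that the empty set and the whole space are allowed) with the same
Lebesgue measure as the corresponding superlevel set of `u`. -/
def IsSchwarzSymmetrization {d : ℕ} (u v : EuclideanSpace ℝ (Fin d) → ℝ≥0∞) : Prop :=
  ∀ s : ℝ≥0∞,
    (∃ r : ℝ≥0∞, {x | s < v x} = {x | edist x 0 < r}) ∧
    volume {x | s < v x} = volume {x | s < u x}

/-- The closed half-spaces of `ℝᵈ` that contain the origin in their interior. The pair `(e, t)`
with `‖e‖ = 1` and `t > 0` stands for `{x | ⟪x, e⟫ ≤ t}`; this parametrization is bijective, and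
the topology is the product topology (half-spaces are close when they are related by
an isometry close to the identity). -/
abbrev HalfSpace (d : ℕ) : Type :=
  Metric.sphere (0 : EuclideanSpace ℝ (Fin d)) 1 × Set.Ioi (0 : ℝ)

namespace HalfSpace

variable {d : ℕ}

/-- The half-space as a set of points. -/
def carrier (H : HalfSpace d) : Set (EuclideanSpace ℝ (Fin d)) :=
  {x | inner ℝ x (H.1 : EuclideanSpace ℝ (Fin d)) ≤ (H.2 : ℝ)}

/-- The reflection across the boundary hyperplane of the half-space. -/
noncomputable def reflect (H : HalfSpace d) (x : EuclideanSpace ℝ (Fin d)) :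
    EuclideanSpace ℝ (Fin d) :=
  x - (2 * (inner ℝ x (H.1 : EuclideanSpace ℝ (Fin d)) - (H.2 : ℝ))) •
    (H.1 : EuclideanSpace ℝ (Fin d))

open Classical in
/-- The polarization `u^H`: the larger of the values of `u` at `x` and at its mirror image is put
inside `H`, the smaller one outside. -/
noncomputable def polarize (H : HalfSpace d) (u : EuclideanSpace ℝ (Fin d) → ℝ≥0∞)
    (x : EuclideanSpace ℝ (Fin d)) : ℝ≥0∞ :=
  if x ∈ H.carrier then max (u x) (u (H.reflect x)) else min (u x) (u (H.reflect x))

end HalfSpace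

/-- `u^{H₀ H₁ ⋯ H_{k-1}}`: successive polarizations, first with respect to `H₀`. -/
noncomputable def polarizeChain {d : ℕ} (H : ℕ → HalfSpace d)
    (u : EuclideanSpace ℝ (Fin d) → ℝ≥0∞) : ℕ → EuclideanSpace ℝ (Fin d) → ℝ≥0∞
  | 0 => u
  | k + 1 => (H k).polarize (polarizeChain H u k)

/-- The polarization algorithm: it starts from `u`, and the `(n+1)`-st step polarizes the current
function successively with respect to `H₀, H₁, …, H_n`. -/
noncomputable def polarizationIterate {d : ℕ} (H : ℕ → HalfSpace d)
    (u : EuclideanSpace ℝ (Fin d) → ℝ≥0∞) : ℕ → EuclideanSpace ℝ (Fin d) → ℝ≥0∞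
  | 0 => u
  | n + 1 => polarizeChain H (polarizationIterate H u n) (n + 1)

/-- The function `|f - g|` for `f`, `g` with values in `[0, ∞]` (one of the two truncated
differences is zero). -/
noncomputable def absDiff {X : Type*} (f g : X → ℝ≥0∞) (x : X) : ℝ≥0∞ :=
  (f x - g x) + (g x - f x)

/-! ### Reflections in hyperplanes that miss the origin. -/

namespace HalfSpace

variable {d : ℕ}

/-! Polarizing a set moves part of it to mirror points nearer the origin. The measure is kept, and
the second moment drops by the integral of a positive function over the added points
(`secondMoment_polarizeSet`). For a bounded set the second moments of the iterates decrease to a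
finite limit, so one more polarization by any fixed `H k` eventually adds almost nothing
(`tendsto_volume_gain_polarizeSetIterate`). If a ball inside the iterate were centred farther out
than a ball missing it, the reflection exchanging the two centres, approximated by one of finitely
many `H k`, would add a ball of fixed size. Hence iterates of sets of finite measure converge to the
centred ball (`tendsto_volume_polarizeSetIterate_sdiff`).

The layer cake formula and dominated convergence turn this into L¹ convergence. Powers commute with
polarization and symmetrization, and |f - g|^p ≤ |f^p - g^p|, so convergence holds in every Lᵖ, p ≥
1, that contains u.

For the grand Lebesgue norm (`memGo_and_tendsto_gNorm`), the bound |u_n - u*|_p ≤ 2|u|_p makes the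
quotients small, uniformly in n, where the weight is large. The other exponents form a bounded set;
there the norms are controlled by those at its infimum and supremum, and the weight is bounded below
unless u vanishes a.e. The first claim reduces to the second because G(ψ) ⊆ Gᵒ(ν)
(`MemG.memGo_of_muchGreater`). -/

lemma norm_normal (H : HalfSpace d) : ‖(H.1 : EuclideanSpace ℝ (Fin d))‖ = 1 := by
  simp

lemma inner_normal_self (H : HalfSpace d) :
    inner ℝ (H.1 : EuclideanSpace ℝ (Fin d)) (H.1 : EuclideanSpace ℝ (Fin d)) = 1 := by
  rw [real_inner_self_eq_norm_sq, norm_normal, one_pow]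

lemma inner_reflect (H : HalfSpace d) (x : EuclideanSpace ℝ (Fin d)) :
    inner ℝ (H.reflect x) (H.1 : EuclideanSpace ℝ (Fin d)) =
      2 * (H.2 : ℝ) - inner ℝ x (H.1 : EuclideanSpace ℝ (Fin d)) := by
  simp only [reflect, inner_sub_left, real_inner_smul_left, inner_normal_self]
  ring

@[simp] lemma reflect_reflect (H : HalfSpace d) (x : EuclideanSpace ℝ (Fin d)) :
    H.reflect (H.reflect x) = x := by
  rw [reflect, inner_reflect, reflect]
  module

lemma norm_reflect_sq (H : HalfSpace d) (x : EuclideanSpace ℝ (Fin d)) :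
    ‖H.reflect x‖ ^ 2 =
      ‖x‖ ^ 2 + 4 * (H.2 : ℝ) * ((H.2 : ℝ) - inner ℝ x (H.1 : EuclideanSpace ℝ (Fin d))) := by
  rw [reflect, norm_sub_sq_real, norm_smul, norm_normal, real_inner_smul_right, Real.norm_eq_abs,
    mul_one, sq_abs]
  ring

lemma dist_sq_reflect (H : HalfSpace d) (x y : EuclideanSpace ℝ (Fin d)) :
    dist x (H.reflect y) ^ 2 = dist x y ^ 2 +
      4 * (inner ℝ x (H.1 : EuclideanSpace ℝ (Fin d)) - H.2) *
        (inner ℝ y (H.1 : EuclideanSpace ℝ (Fin d)) - H.2) := by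
  rw [dist_eq_norm, dist_eq_norm, reflect, ← sub_add, norm_add_sq_real, norm_smul, norm_normal,
    real_inner_smul_right, Real.norm_eq_abs, mul_one, sq_abs, inner_sub_left]
  ring

lemma dist_reflect_reflect (H : HalfSpace d) (x y : EuclideanSpace ℝ (Fin d)) :
    dist (H.reflect x) (H.reflect y) = dist x y := by
  refine (pow_left_inj₀ dist_nonneg dist_nonneg two_ne_zero).1 ?_
  rw [dist_sq_reflect, dist_comm, dist_sq_reflect, inner_reflect, dist_comm]
  ring

/-- The cross term in `dist_sq_reflect` is nonpositive for points on opposite sides. -/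
lemma dist_reflect_le {H : HalfSpace d} {x y : EuclideanSpace ℝ (Fin d)} (hx : x ∈ H.carrier)
    (hy : y ∉ H.carrier) : dist x (H.reflect y) ≤ dist x y := by
  refine (pow_le_pow_iff_left₀ dist_nonneg dist_nonneg two_ne_zero).1 ?_
  rw [dist_sq_reflect]
  simp only [carrier, mem_ofPred_eq, not_le] at hx hy
  nlinarith [mul_nonneg (sub_nonneg.2 hx) (sub_pos.2 hy).le]

/-- Here the positivity of the offset enters: the origin lies on the side of H. -/
lemma norm_le_norm_reflect {H : HalfSpace d} {x : EuclideanSpace ℝ (Fin d)}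
    (hx : x ∈ H.carrier) : ‖x‖ ≤ ‖H.reflect x‖ := by
  refine (pow_le_pow_iff_left₀ (norm_nonneg _) (norm_nonneg _) two_ne_zero).1 ?_
  rw [norm_reflect_sq]
  simp only [carrier, mem_ofPred_eq] at hx
  have : (0 : ℝ) < H.2 := H.2.2
  nlinarith [mul_nonneg this.le (sub_nonneg.2 hx)]

lemma isometry_reflect (H : HalfSpace d) : Isometry H.reflect :=
  Isometry.of_dist_eq H.dist_reflect_reflect

lemma measurable_reflect (H : HalfSpace d) : Measurable H.reflect :=
  H.isometry_reflect.continuous.measurable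

lemma measurableSet_carrier (H : HalfSpace d) : MeasurableSet H.carrier :=
  (isClosed_le (by fun_prop) continuous_const).measurableSet

lemma measurePreserving_reflect (H : HalfSpace d) :
    MeasurePreserving H.reflect (volume : Measure (EuclideanSpace ℝ (Fin d))) volume := by
  have key : H.reflect = (fun x => x + (2 * (H.2 : ℝ)) • (H.1 : EuclideanSpace ℝ (Fin d))) ∘
      (Submodule.span ℝ {(H.1 : EuclideanSpace ℝ (Fin d))})ᗮ.reflection := by
    ext1 x
    simp only [Function.comp, Submodule.reflection_orthogonal_apply,
      Submodule.reflection_singleton_apply, norm_normal, reflect, real_inner_comm x]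
    norm_num
    module
  rw [key]
  exact (measurePreserving_add_right volume _).comp (LinearIsometryEquiv.measurePreserving _)

lemma lintegral_comp_reflect (H : HalfSpace d) (f : EuclideanSpace ℝ (Fin d) → ℝ≥0∞)
    (hf : Measurable f) : ∫⁻ x, f (H.reflect x) = ∫⁻ x, f x :=
  H.measurePreserving_reflect.lintegral_comp hf

/-! ### Polarization of sets -/

/-- The polarization of a set: the superlevel sets of `u^H` are the polarizations of the
superlevel sets of `u`. -/
def polarizeSet (H : HalfSpace d) (A : Set (EuclideanSpace ℝ (Fin d))) :
    Set (EuclideanSpace ℝ (Fin d)) :=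
  {x | (x ∈ H.carrier ∧ (x ∈ A ∨ H.reflect x ∈ A)) ∨
    (x ∉ H.carrier ∧ x ∈ A ∧ H.reflect x ∈ A)}

/-- The points of the half-space that polarization adds to a set. -/
def gain (H : HalfSpace d) (A : Set (EuclideanSpace ℝ (Fin d))) :
    Set (EuclideanSpace ℝ (Fin d)) :=
  {x | x ∈ H.carrier ∧ x ∉ A ∧ H.reflect x ∈ A}

lemma reflect_eq_self {H : HalfSpace d} {x : EuclideanSpace ℝ (Fin d)} (hx : x ∈ H.carrier)
    (hx' : H.reflect x ∈ H.carrier) : H.reflect x = x := by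
  simp only [carrier, mem_ofPred_eq, inner_reflect] at hx hx'
  have : inner ℝ x (H.1 : EuclideanSpace ℝ (Fin d)) - H.2 = 0 := by linarith
  simp [reflect, this]

lemma reflect_mem_of_notMem {H : HalfSpace d} {x : EuclideanSpace ℝ (Fin d)}
    (hx : x ∉ H.carrier) : H.reflect x ∈ H.carrier := by
  simp only [carrier, mem_ofPred_eq, inner_reflect, not_le] at hx ⊢
  linarith

lemma measurableSet_polarizeSet (H : HalfSpace d) {A : Set (EuclideanSpace ℝ (Fin d))}
    (hA : MeasurableSet A) : MeasurableSet (H.polarizeSet A) :=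
  (H.measurableSet_carrier.inter (hA.union (H.measurable_reflect hA))).union
    (H.measurableSet_carrier.compl.inter (hA.inter (H.measurable_reflect hA)))

lemma measurableSet_gain (H : HalfSpace d) {A : Set (EuclideanSpace ℝ (Fin d))}
    (hA : MeasurableSet A) : MeasurableSet (H.gain A) :=
  H.measurableSet_carrier.inter (hA.compl.inter (H.measurable_reflect hA))

lemma polarizeSet_mono (H : HalfSpace d) {A B : Set (EuclideanSpace ℝ (Fin d))} (h : A ⊆ B) :
    H.polarizeSet A ⊆ H.polarizeSet B := by
  rintro x (⟨hx, h1 | h1⟩ | ⟨hx, h1, h2⟩)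
  · exact Or.inl ⟨hx, Or.inl (h h1)⟩
  · exact Or.inl ⟨hx, Or.inr (h h1)⟩
  · exact Or.inr ⟨hx, h h1, h h2⟩

lemma setOf_lt_polarize (H : HalfSpace d) (u : EuclideanSpace ℝ (Fin d) → ℝ≥0∞) (s : ℝ≥0∞) :
    {x | s < H.polarize u x} = H.polarizeSet {x | s < u x} := by
  ext x
  by_cases hx : x ∈ H.carrier <;> simp [polarize, polarizeSet, hx]

lemma polarizeSet_sdiff_self (H : HalfSpace d) (A : Set (EuclideanSpace ℝ (Fin d))) :
    H.polarizeSet A \ A = H.gain A := by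
  ext x
  simp only [polarizeSet, gain, Set.mem_sdiff, mem_ofPred_eq]
  tauto

/-- Polarization only swaps points with their mirror images, so the loss mirrors the gain; boundary
points are fixed and belong to neither. -/
lemma sdiff_polarizeSet_self (H : HalfSpace d) (A : Set (EuclideanSpace ℝ (Fin d))) :
    A \ H.polarizeSet A = H.reflect ⁻¹' H.gain A := by
  ext x
  simp only [polarizeSet, gain, Set.mem_sdiff, mem_ofPred_eq, mem_preimage, reflect_reflect]
  by_cases hx : x ∈ H.carrier
  · by_cases hx' : H.reflect x ∈ H.carrier
    · rw [reflect_eq_self hx hx']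
      tauto
    · tauto
  · have := reflect_mem_of_notMem hx
    tauto

lemma volume_reflect_preimage_gain (H : HalfSpace d) {A : Set (EuclideanSpace ℝ (Fin d))}
    (hA : MeasurableSet A) : volume (H.reflect ⁻¹' H.gain A) = volume (H.gain A) :=
  H.measurePreserving_reflect.measure_preimage (H.measurableSet_gain hA).nullMeasurableSet

lemma volume_polarizeSet (H : HalfSpace d) {A : Set (EuclideanSpace ℝ (Fin d))}
    (hA : MeasurableSet A) : volume (H.polarizeSet A) = volume A := by
  rw [← measure_inter_add_sdiff A (H.measurableSet_polarizeSet hA), sdiff_polarizeSet_self,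
    H.volume_reflect_preimage_gain hA, ← measure_inter_add_sdiff (H.polarizeSet A) hA,
    polarizeSet_sdiff_self, inter_comm]

/-- Polarization does not increase distance in measure: by monotonicity B may be replaced by A ∩ B,
and for nested sets of finite measure only the measures count. -/
lemma volume_polarizeSet_sdiff_le (H : HalfSpace d) {A B : Set (EuclideanSpace ℝ (Fin d))}
    (hA : MeasurableSet A) (hB : MeasurableSet B) (hAf : volume A ≠ ∞) :
    volume (H.polarizeSet A \ H.polarizeSet B) ≤ volume (A \ B) := by
  have hAB := hA.inter hB
  have hf : volume (A ∩ B) ≠ ∞ := measure_ne_top_of_subset inter_subset_left hAf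
  calc volume (H.polarizeSet A \ H.polarizeSet B)
      ≤ volume (H.polarizeSet A \ H.polarizeSet (A ∩ B)) :=
        measure_mono (sdiff_subset_sdiff_right (H.polarizeSet_mono inter_subset_right))
    _ = volume A - volume (A ∩ B) := by
        rw [measure_sdiff (H.polarizeSet_mono inter_subset_left)
          (H.measurableSet_polarizeSet hAB).nullMeasurableSet (by rwa [H.volume_polarizeSet hAB]),
          H.volume_polarizeSet hAB, H.volume_polarizeSet hA]
    _ = volume (A \ B) := by
        rw [← measure_sdiff inter_subset_left hAB.nullMeasurableSet hf, sdiff_self_inter]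

lemma polarizeSet_subset_ball (H : HalfSpace d) {A : Set (EuclideanSpace ℝ (Fin d))} {R : ℝ}
    (hA : A ⊆ Metric.ball 0 R) : H.polarizeSet A ⊆ Metric.ball 0 R := by
  rintro x (⟨hx, h1 | h1⟩ | ⟨-, h1, -⟩)
  · exact hA h1
  · have := hA h1
    rw [mem_ball_zero_iff] at this ⊢
    exact (norm_le_norm_reflect hx).trans_lt this
  · exact hA h1

/-- Reflection is an isometry, and reflecting one of two points on opposite sides brings them no
farther apart. So room around a set survives polarization. -/
lemma thickening_polarizeSet_subset (H : HalfSpace d) {A B : Set (EuclideanSpace ℝ (Fin d))}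
    {δ : ℝ} (h : Metric.thickening δ A ⊆ B) :
    Metric.thickening δ (H.polarizeSet A) ⊆ H.polarizeSet B := by
  have h' : ∀ x ∈ A, ∀ y, dist y x < δ → y ∈ B := fun x hx y hxy =>
    h (Metric.mem_thickening_iff.2 ⟨x, hx, hxy⟩)
  intro y hy
  obtain ⟨x, hx, hxy⟩ := Metric.mem_thickening_iff.1 hy
  have hr : dist (H.reflect y) (H.reflect x) < δ := by rwa [dist_reflect_reflect]
  by_cases hyH : y ∈ H.carrier
  · refine Or.inl ⟨hyH, ?_⟩
    rcases hx with ⟨-, h1 | h1⟩ | ⟨-, h1, -⟩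
    · exact Or.inl (h' _ h1 _ hxy)
    · exact Or.inr (h' _ h1 _ hr)
    · exact Or.inl (h' _ h1 _ hxy)
  · refine Or.inr ⟨hyH, ?_⟩
    rcases hx with ⟨hxH, h1 | h1⟩ | ⟨-, h1, h2⟩
    · refine ⟨h' _ h1 _ hxy, h' _ h1 _ ?_⟩
      rw [dist_comm] at hxy ⊢
      exact (dist_reflect_le hxH hyH).trans_lt hxy
    · refine ⟨h' _ h1 _ ?_, h' _ h1 _ hr⟩
      rw [← H.dist_reflect_reflect, reflect_reflect, dist_comm]
      rw [dist_comm] at hxy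
      exact (dist_reflect_le hxH hyH).trans_lt hxy
    · exact ⟨h' _ h1 _ hxy, h' _ h2 _ hr⟩

/-! ### The second moment -/

/-- The second moment of a set. -/
noncomputable def secondMoment (A : Set (EuclideanSpace ℝ (Fin d))) : ℝ≥0∞ :=
  ∫⁻ x in A, ENNReal.ofReal (‖x‖ ^ 2)

/-- Each gained point x replaces its mirror image, and `norm_reflect_sq` gives the saving. The
additive form avoids subtraction in [0, ∞]. -/
lemma secondMoment_polarizeSet (H : HalfSpace d) {A : Set (EuclideanSpace ℝ (Fin d))}
    (hA : MeasurableSet A) :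
    secondMoment (H.polarizeSet A) + ∫⁻ x in H.gain A, ENNReal.ofReal (4 * (H.2 : ℝ) *
      ((H.2 : ℝ) - inner ℝ x (H.1 : EuclideanSpace ℝ (Fin d)))) = secondMoment A := by
  have hm : Measurable fun x : EuclideanSpace ℝ (Fin d) => ENNReal.ofReal (‖x‖ ^ 2) := by fun_prop
  have hG := H.measurableSet_gain hA
  rw [secondMoment, secondMoment, ← lintegral_inter_add_sdiff _ (H.polarizeSet A) hA,
    polarizeSet_sdiff_self, add_assoc, ← lintegral_add_left hm,
    ← lintegral_inter_add_sdiff _ A (H.measurableSet_polarizeSet hA), sdiff_polarizeSet_self,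
    inter_comm]
  congr 1
  rw [← lintegral_indicator (H.measurable_reflect hG),
    ← H.lintegral_comp_reflect _ (hm.indicator (H.measurable_reflect hG)),
    ← lintegral_indicator hG]
  congr 1
  ext1 x
  by_cases hx : x ∈ H.gain A
  · have hx' : H.reflect x ∈ H.reflect ⁻¹' H.gain A := by simpa using hx
    have hxH : inner ℝ x (H.1 : EuclideanSpace ℝ (Fin d)) ≤ H.2 := hx.1
    have ht : (0 : ℝ) < H.2 := H.2.2
    rw [indicator_of_mem hx, indicator_of_mem hx', norm_reflect_sq,
      ENNReal.ofReal_add (by positivity)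
        (mul_nonneg (by positivity) (sub_nonneg.2 hxH))]
  · have hx' : H.reflect x ∉ H.reflect ⁻¹' H.gain A := by simpa using hx
    rw [indicator_of_notMem hx, indicator_of_notMem hx']

lemma secondMoment_polarizeSet_le (H : HalfSpace d) {A : Set (EuclideanSpace ℝ (Fin d))}
    (hA : MeasurableSet A) : secondMoment (H.polarizeSet A) ≤ secondMoment A :=
  (H.secondMoment_polarizeSet hA) ▸ le_self_add

lemma secondMoment_ne_top {A : Set (EuclideanSpace ℝ (Fin d))} {R : ℝ}
    (hA : A ⊆ Metric.ball 0 R) : secondMoment A ≠ ∞ := by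
  refine ((lintegral_mono_set hA).trans_lt ((setLIntegral_mono' (g := fun _ => ENNReal.ofReal (R ^ 2))
    Metric.isOpen_ball.measurableSet fun x hx => ?_).trans_lt ?_)).ne
  · rw [mem_ball_zero_iff] at hx
    gcongr
  · rw [setLIntegral_const]
    exact ENNReal.mul_lt_top ENNReal.ofReal_lt_top measure_ball_lt_top

end HalfSpace

/-- Absolute continuity of the integral of 1/g with respect to g·μ, which is finite because μ is. -/
lemma tendsto_measure_zero_of_tendsto_setLIntegral_zero {α : Type*} [MeasurableSpace α]
    {μ : Measure α} [IsFiniteMeasure μ] {g : α → ℝ≥0∞} (hg : Measurable g) {S : ℕ → Set α}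
    (hS : ∀ n, MeasurableSet (S n)) (hpos : ∀ n, ∀ x ∈ S n, g x ≠ 0) (htop : ∀ x, g x ≠ ∞)
    (h : Tendsto (fun n => ∫⁻ x in S n, g x ∂μ) atTop (𝓝 0)) :
    Tendsto (fun n => μ (S n)) atTop (𝓝 0) := by
  have hinv : Measurable fun x => (g x)⁻¹ := hg.inv
  have hfin : ∫⁻ x, (g x)⁻¹ ∂(μ.withDensity g) ≠ ∞ := by
    rw [lintegral_withDensity_eq_lintegral_mul _ hg hinv]
    refine ((lintegral_mono fun x => ?_).trans_lt
      (by simp : ∫⁻ _, 1 ∂μ < ∞)).ne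
    exact ENNReal.mul_inv_le_one _
  have h' : Tendsto (fun n => μ.withDensity g (S n)) atTop (𝓝 0) := by
    simpa only [withDensity_apply _ (hS _)] using h
  refine (tendsto_setLIntegral_zero hfin h').congr fun n => ?_
  rw [setLIntegral_withDensity_eq_setLIntegral_mul _ hg hinv (hS n), ← setLIntegral_one]
  exact setLIntegral_congr_fun (hS n) fun x hx => ENNReal.mul_inv_cancel (hpos n x hx) (htop x)

/-- Successive polarization of a set. -/
def polarizeSetChain {d : ℕ} (H : ℕ → HalfSpace d) (A : Set (EuclideanSpace ℝ (Fin d))) :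
    ℕ → Set (EuclideanSpace ℝ (Fin d))
  | 0 => A
  | k + 1 => (H k).polarizeSet (polarizeSetChain H A k)

/-- The polarization algorithm for sets. -/
def polarizeSetIterate {d : ℕ} (H : ℕ → HalfSpace d) (A : Set (EuclideanSpace ℝ (Fin d))) :
    ℕ → Set (EuclideanSpace ℝ (Fin d))
  | 0 => A
  | n + 1 => polarizeSetChain H (polarizeSetIterate H A n) (n + 1)

/-! ### Iterated polarization of sets: the gains tend to zero. -/

section

variable {d : ℕ} {H : ℕ → HalfSpace d} {A B : Set (EuclideanSpace ℝ (Fin d))}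

/-- Transfers any relation preserved by one polarization; properties of a single set are obtained by
ignoring the second argument. -/
lemma polarizeSetChain_rel {r : Set (EuclideanSpace ℝ (Fin d)) → Set (EuclideanSpace ℝ (Fin d)) →
    Prop} (h : ∀ (H : HalfSpace d) A B, r A B → r (H.polarizeSet A) (H.polarizeSet B))
    (hAB : r A B) (n : ℕ) : r (polarizeSetChain H A n) (polarizeSetChain H B n) := by
  induction n with
  | zero => exact hAB
  | succ n ih => exact h _ _ _ ih

lemma polarizeSetIterate_rel {r : Set (EuclideanSpace ℝ (Fin d)) →
    Set (EuclideanSpace ℝ (Fin d)) → Prop}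
    (h : ∀ (H : HalfSpace d) A B, r A B → r (H.polarizeSet A) (H.polarizeSet B))
    (hAB : r A B) (n : ℕ) : r (polarizeSetIterate H A n) (polarizeSetIterate H B n) := by
  induction n with
  | zero => exact hAB
  | succ n ih => exact polarizeSetChain_rel h ih _

lemma setOf_lt_polarizeChain (u : EuclideanSpace ℝ (Fin d) → ℝ≥0∞) (s : ℝ≥0∞) (n : ℕ) :
    {x | s < polarizeChain H u n x} = polarizeSetChain H {x | s < u x} n := by
  induction n with
  | zero => rfl
  | succ n ih => rw [polarizeChain, HalfSpace.setOf_lt_polarize, ih, polarizeSetChain]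

lemma setOf_lt_polarizationIterate (u : EuclideanSpace ℝ (Fin d) → ℝ≥0∞) (s : ℝ≥0∞) (n : ℕ) :
    {x | s < polarizationIterate H u n x} = polarizeSetIterate H {x | s < u x} n := by
  induction n with
  | zero => rfl
  | succ n ih => rw [polarizationIterate, setOf_lt_polarizeChain, ih, polarizeSetIterate]

lemma measurableSet_polarizeSetChain (hA : MeasurableSet A) (n : ℕ) :
    MeasurableSet (polarizeSetChain H A n) :=
  polarizeSetChain_rel (r := fun A _ => MeasurableSet A) (B := A)
    (fun H _ _ h => H.measurableSet_polarizeSet h) hA n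

lemma measurableSet_polarizeSetIterate (hA : MeasurableSet A) (n : ℕ) :
    MeasurableSet (polarizeSetIterate H A n) :=
  polarizeSetIterate_rel (r := fun A _ => MeasurableSet A) (B := A)
    (fun H _ _ h => H.measurableSet_polarizeSet h) hA n

lemma polarizeSetChain_subset_ball {R : ℝ} (hA : A ⊆ Metric.ball 0 R) (n : ℕ) :
    polarizeSetChain H A n ⊆ Metric.ball 0 R :=
  polarizeSetChain_rel (r := fun A _ => A ⊆ Metric.ball 0 R) (B := A)
    (fun H _ _ h => H.polarizeSet_subset_ball h) hA n

lemma polarizeSetIterate_subset_ball {R : ℝ} (hA : A ⊆ Metric.ball 0 R) (n : ℕ) :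
    polarizeSetIterate H A n ⊆ Metric.ball 0 R :=
  polarizeSetIterate_rel (r := fun A _ => A ⊆ Metric.ball 0 R) (B := A)
    (fun H _ _ h => H.polarizeSet_subset_ball h) hA n

lemma volume_polarizeSetIterate (hA : MeasurableSet A) (n : ℕ) :
    volume (polarizeSetIterate H A n) = volume A :=
  (polarizeSetIterate_rel (r := fun C _ => MeasurableSet C ∧ volume C = volume A) (B := A)
    (fun H _ _ h => ⟨H.measurableSet_polarizeSet h.1, (H.volume_polarizeSet h.1).trans h.2⟩)
    ⟨hA, rfl⟩ n).2

lemma thickening_polarizeSetIterate_subset {δ : ℝ} (h : Metric.thickening δ A ⊆ B) (n : ℕ) :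
    Metric.thickening δ (polarizeSetIterate H A n) ⊆ polarizeSetIterate H B n :=
  polarizeSetIterate_rel (r := fun A B => Metric.thickening δ A ⊆ B)
    (fun H _ _ h => H.thickening_polarizeSet_subset h) h n

lemma volume_polarizeSetIterate_sdiff_le (hA : MeasurableSet A) (hB : MeasurableSet B)
    (hAf : volume A ≠ ∞) (n : ℕ) :
    volume (polarizeSetIterate H A n \ polarizeSetIterate H B n) ≤ volume (A \ B) :=
  (polarizeSetIterate_rel (r := fun C D => (MeasurableSet C ∧ MeasurableSet D ∧ volume C ≠ ∞) ∧
      volume (C \ D) ≤ volume (A \ B))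
    (fun H _ _ h => ⟨⟨H.measurableSet_polarizeSet h.1.1, H.measurableSet_polarizeSet h.1.2.1,
      by rw [H.volume_polarizeSet h.1.1]; exact h.1.2.2⟩,
      (H.volume_polarizeSet_sdiff_le h.1.1 h.1.2.1 h.1.2.2).trans h.2⟩)
    ⟨⟨hA, hB, hAf⟩, le_rfl⟩ n).2

open HalfSpace

lemma secondMoment_polarizeSetChain_antitone (hA : MeasurableSet A) :
    Antitone fun n => secondMoment (polarizeSetChain H A n) :=
  antitone_nat_of_succ_le fun n =>
    (H n).secondMoment_polarizeSet_le (measurableSet_polarizeSetChain hA n)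

lemma secondMoment_polarizeSetIterate_antitone (hA : MeasurableSet A) :
    Antitone fun n => secondMoment (polarizeSetIterate H A n) :=
  antitone_nat_of_succ_le fun n =>
    secondMoment_polarizeSetChain_antitone (measurableSet_polarizeSetIterate hA n)
      (Nat.zero_le (n + 1))

/-- The saving of second moment at stage k of a step is at most the drop over the whole step, and
these drops tend to zero. -/
lemma tendsto_volume_gain_polarizeSetChain (hA : MeasurableSet A) {R : ℝ}
    (hR : A ⊆ Metric.ball 0 R) (k : ℕ) :
    Tendsto (fun n => volume ((H k).gain (polarizeSetChain H (polarizeSetIterate H A n) k)))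
      atTop (𝓝 0) := by
  set g : EuclideanSpace ℝ (Fin d) → ℝ≥0∞ := fun x => ENNReal.ofReal (4 * ((H k).2 : ℝ) *
      (((H k).2 : ℝ) - inner ℝ x ((H k).1 : EuclideanSpace ℝ (Fin d)))) with hg
  set S := fun n => (H k).gain (polarizeSetChain H (polarizeSetIterate H A n) k) with hS
  have hMm : ∀ n, MeasurableSet (polarizeSetChain H (polarizeSetIterate H A n) k) := fun n =>
    measurableSet_polarizeSetChain (measurableSet_polarizeSetIterate hA n) k
  have hMb : ∀ n, polarizeSetChain H (polarizeSetIterate H A n) k ⊆ Metric.ball 0 R := fun n =>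
    polarizeSetChain_subset_ball (polarizeSetIterate_subset_ball hR n) k
  have hSm : ∀ n, MeasurableSet (S n) := fun n => (H k).measurableSet_gain (hMm n)
  have hSb : ∀ n, S n ⊆ Metric.ball 0 R := fun n => by
    simp only [hS]
    rw [← polarizeSet_sdiff_self]
    exact sdiff_subset.trans ((H k).polarizeSet_subset_ball (hMb n))
  have key : Tendsto (fun n => ∫⁻ x in S n, g x) atTop (𝓝 0) := by
    have hlim := tendsto_atTop_iInf (secondMoment_polarizeSetIterate_antitone (H := H) hA)
    have hne : ⨅ n, secondMoment (polarizeSetIterate H A n) ≠ ∞ :=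
      ((iInf_le _ 0).trans_lt (secondMoment_ne_top hR).lt_top).ne
    have hsub := ENNReal.Tendsto.sub hlim (hlim.comp (tendsto_add_atTop_nat 1)) (Or.inl hne)
    rw [tsub_self] at hsub
    refine tendsto_of_tendsto_of_tendsto_of_le_of_le' tendsto_const_nhds hsub
      (Eventually.of_forall fun _ => zero_le) ?_
    -- The step from n to n + 1 uses `H 0`, …, `H n`, so `H k` takes part only if k ≤ n.
    filter_upwards [eventually_ge_atTop k] with n hn
    have h1 := (H k).secondMoment_polarizeSet (hMm n)
    have h2 : secondMoment (polarizeSetIterate H A (n + 1)) ≤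
        secondMoment ((H k).polarizeSet (polarizeSetChain H (polarizeSetIterate H A n) k)) :=
      secondMoment_polarizeSetChain_antitone (measurableSet_polarizeSetIterate hA n)
        (show k + 1 ≤ n + 1 by omega)
    have h3 : secondMoment (polarizeSetChain H (polarizeSetIterate H A n) k) ≤
        secondMoment (polarizeSetIterate H A n) :=
      secondMoment_polarizeSetChain_antitone (measurableSet_polarizeSetIterate hA n)
        (Nat.zero_le k)
    refine ENNReal.le_sub_of_add_le_left
      (secondMoment_ne_top (polarizeSetIterate_subset_ball hR (n + 1))) ?_
    exact (add_le_add_left h2 _).trans (h1.le.trans h3)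
  have hSball : ∀ n, S n ∩ Metric.ball 0 R = S n := fun n => inter_eq_left.2 (hSb n)
  have : IsFiniteMeasure (volume.restrict (Metric.ball (0 : EuclideanSpace ℝ (Fin d)) R)) :=
    ⟨by simpa using measure_ball_lt_top⟩
  have := tendsto_measure_zero_of_tendsto_setLIntegral_zero
    (μ := volume.restrict (Metric.ball (0 : EuclideanSpace ℝ (Fin d)) R)) (g := g) (S := S)
    (by fun_prop) hSm ?_ (fun _ => ENNReal.ofReal_ne_top) ?_
  · simpa only [Measure.restrict_apply (hSm _), hSball] using this
  · rintro n x ⟨hxH, hx, hx'⟩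
    have ht : (0 : ℝ) < (H k).2 := (H k).2.2
    have : 0 < ((H k).2 : ℝ) - inner ℝ x ((H k).1 : EuclideanSpace ℝ (Fin d)) := by
      -- A point on the boundary is its own mirror image and cannot be gained.
      refine lt_of_le_of_ne (sub_nonneg.2 hxH) fun h => hx ?_
      have h0 : inner ℝ x ((H k).1 : EuclideanSpace ℝ (Fin d)) - ((H k).2 : ℝ) = 0 := by linarith
      simpa [reflect, h0] using hx'
    simp only [hg, ne_eq, ENNReal.ofReal_eq_zero, not_le]
    positivity
  · simpa only [Measure.restrict_restrict (hSm _), hSball] using key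

/-- The gains of stages 0, …, k tend to zero, so stages k and k + 1 stay close to the iterate
itself; since polarization by `H k` is nonexpansive, it barely changes the iterate. -/
lemma tendsto_volume_gain_polarizeSetIterate (hA : MeasurableSet A) {R : ℝ}
    (hR : A ⊆ Metric.ball 0 R) (k : ℕ) :
    Tendsto (fun n => volume ((H k).gain (polarizeSetIterate H A n))) atTop (𝓝 0) := by
  set M := polarizeSetIterate H A with hM
  have hMm : ∀ n, MeasurableSet (M n) := measurableSet_polarizeSetIterate hA
  have hCm : ∀ n j, MeasurableSet (polarizeSetChain H (M n) j) := fun n =>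
    measurableSet_polarizeSetChain (hMm n)
  have tri : ∀ C D E : Set (EuclideanSpace ℝ (Fin d)),
      volume (C \ E) ≤ volume (C \ D) + volume (D \ E) := fun C D E =>
    (measure_mono (sdiff_triangle C D E)).trans (measure_union_le _ _)
  have step : ∀ j, Tendsto (fun n => volume (M n \ polarizeSetChain H (M n) j)) atTop (𝓝 0) ∧
      Tendsto (fun n => volume (polarizeSetChain H (M n) j \ M n)) atTop (𝓝 0) := by
    intro j
    have hg := fun j => tendsto_volume_gain_polarizeSetChain (H := H) hA hR j
    induction j with
    | zero => simp [polarizeSetChain]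
    | succ j ih =>
      have h1 := ih.1.add (hg j)
      have h2 := (hg j).add ih.2
      rw [add_zero] at h1 h2
      constructor
      · refine tendsto_of_tendsto_of_tendsto_of_le_of_le tendsto_const_nhds h1
          (fun _ => zero_le) fun n => (tri _ (polarizeSetChain H (M n) j) _).trans ?_
        rw [polarizeSetChain, sdiff_polarizeSet_self, volume_reflect_preimage_gain _ (hCm n j)]
      · refine tendsto_of_tendsto_of_tendsto_of_le_of_le tendsto_const_nhds h2
          (fun _ => zero_le) fun n => (tri _ (polarizeSetChain H (M n) j) _).trans ?_
        rw [polarizeSetChain, polarizeSet_sdiff_self]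
  have h := (step k).1.add (step (k + 1)).2
  rw [add_zero] at h
  refine tendsto_of_tendsto_of_tendsto_of_le_of_le tendsto_const_nhds h
    (fun _ => zero_le) fun n => ?_
  simp only
  rw [← polarizeSet_sdiff_self]
  refine (tri _ (polarizeSetChain H (M n) (k + 1)) _).trans (add_le_add_left ?_ _)
  rw [polarizeSetChain]
  refine (H k).volume_polarizeSet_sdiff_le (hMm n) (hCm n k) (measure_ne_top_of_subset
    (polarizeSetIterate_subset_ball hR n) measure_ball_lt_top.ne)

end

/-! ### The space of half-spaces: bisectors and finite nets. -/

namespace HalfSpace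

variable {d : ℕ}

/-- The boundary is the perpendicular bisector of x and y. Its offset t is positive because y is
nearer the origin, and t ≤ (‖x‖ + ‖y‖)/2. -/
lemma exists_reflect_eq {x y : EuclideanSpace ℝ (Fin d)} (h : ‖y‖ < ‖x‖) :
    ∃ H : HalfSpace d, H.reflect y = x ∧ (H.2 : ℝ) ≤ ‖x‖ ∧
      inner ℝ y (H.1 : EuclideanSpace ℝ (Fin d)) - (H.2 : ℝ) = -(‖x - y‖ / 2) := by
  have hxy : 0 < ‖x - y‖ := norm_pos_iff.2 (sub_ne_zero.2 fun e => h.ne (by rw [e]))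
  set e : EuclideanSpace ℝ (Fin d) := ‖x - y‖⁻¹ • (x - y) with he
  have hen : ‖e‖ = 1 := by rw [he, norm_smul, norm_inv, norm_norm, inv_mul_cancel₀ hxy.ne']
  set t : ℝ := (‖x‖ ^ 2 - ‖y‖ ^ 2) / (2 * ‖x - y‖) with ht
  have htpos : 0 < t := div_pos (by nlinarith [norm_nonneg y]) (by positivity)
  have hsq := norm_sub_sq_real x y
  have hin : inner ℝ y e - t = -(‖x - y‖ / 2) := by
    rw [he, real_inner_smul_right, inner_sub_right, real_inner_self_eq_norm_sq, ht,
      real_inner_comm]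
    field_simp
    linarith
  refine ⟨(⟨e, by simpa using hen⟩, ⟨t, htpos⟩), ?_, ?_, hin⟩
  · simp only [reflect, hin]
    rw [he, smul_smul]
    have : 2 * -(‖x - y‖ / 2) * ‖x - y‖⁻¹ = -1 := by field_simp
    rw [this]
    module
  · simp only
    rw [ht, div_le_iff₀ (by positivity)]
    have h1 : ‖x‖ - ‖y‖ ≤ ‖x - y‖ := norm_sub_norm_le x y
    nlinarith [norm_nonneg y]

lemma dist_reflect_reflect_le (H H' : HalfSpace d) (y : EuclideanSpace ℝ (Fin d)) :
    dist (H.reflect y) (H'.reflect y) ≤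
      2 * ((2 * ‖y‖ + (H.2 : ℝ)) * dist (H.1 : EuclideanSpace ℝ (Fin d)) H'.1
        + dist (H.2 : ℝ) H'.2) := by
  set e := (H.1 : EuclideanSpace ℝ (Fin d))
  set e' := (H'.1 : EuclideanSpace ℝ (Fin d))
  have ht : (0 : ℝ) < H.2 := H.2.2
  have key : H'.reflect y - H.reflect y = (2 : ℝ) • ((inner ℝ y e - (H.2 : ℝ)) • (e - e') +
      (inner ℝ y (e - e') - ((H.2 : ℝ) - H'.2)) • e') := by
    simp only [reflect, inner_sub_right, e, e']
    module
  rw [dist_comm, dist_eq_norm, key, norm_smul, Real.norm_two]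
  refine mul_le_mul_of_nonneg_left ?_ zero_le_two
  have he : ‖e‖ = 1 := H.norm_normal
  have he' : ‖e'‖ = 1 := H'.norm_normal
  have h1 : |inner ℝ y e| ≤ ‖y‖ := by simpa [he] using abs_real_inner_le_norm y e
  have h2 : |inner ℝ y (e - e')| ≤ ‖y‖ * ‖e - e'‖ := abs_real_inner_le_norm y (e - e')
  have h3 : |inner ℝ y e - (H.2 : ℝ)| ≤ ‖y‖ + (H.2 : ℝ) :=
    (abs_sub _ _).trans (by rw [abs_of_pos ht]; gcongr)
  refine (norm_add_le _ _).trans ?_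
  rw [norm_smul, norm_smul, he', mul_one, Real.norm_eq_abs, Real.norm_eq_abs, dist_eq_norm,
    Real.dist_eq]
  have h4 := abs_sub (inner ℝ y (e - e')) ((H.2 : ℝ) - H'.2)
  nlinarith [mul_le_mul_of_nonneg_right h3 (norm_nonneg (e - e'))]

/-- This set need not be compact, as offsets may tend to 0, but total boundedness is enough for
finite nets. -/
lemma totallyBounded_setOf_le (R : ℝ) : TotallyBounded {H : HalfSpace d | (H.2 : ℝ) ≤ R} := by
  have hi : IsUniformInducing fun H : HalfSpace d =>
      ((H.1 : EuclideanSpace ℝ (Fin d)), (H.2 : ℝ)) :=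
    (isUniformEmbedding_subtype_val.isUniformInducing).prod
      isUniformEmbedding_subtype_val.isUniformInducing
  have hb : Bornology.IsBounded
      (Metric.sphere (0 : EuclideanSpace ℝ (Fin d)) 1 ×ˢ Icc (0 : ℝ) R) :=
    Metric.isBounded_sphere.prod (Metric.isBounded_Icc 0 R)
  have ht := (Bornology.IsBounded.isCompact_closure hb).totallyBounded.subset subset_closure
  have hp := totallyBounded_preimage hi ht
  refine hp.subset ?_
  intro G hG
  exact ⟨G.1.2, G.2.2.le, hG⟩

lemma exists_finset_dist_lt {H : ℕ → HalfSpace d} (hH : DenseRange H) (R : ℝ) {τ : ℝ}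
    (hτ : 0 < τ) : ∃ F : Finset ℕ, ∀ G : HalfSpace d, (G.2 : ℝ) ≤ R → ∃ k ∈ F, dist G (H k) < τ := by
  obtain ⟨t, ht, hcov⟩ := Metric.totallyBounded_iff.1 (totallyBounded_setOf_le (d := d) R) (τ / 2)
    (half_pos hτ)
  choose k hk using fun G : HalfSpace d => hH.exists_dist_lt G (half_pos hτ)
  refine ⟨ht.toFinset.image k, fun G hG => ?_⟩
  obtain ⟨c, hc, hGc⟩ := mem_iUnion₂.1 (hcov hG)
  refine ⟨k c, Finset.mem_image_of_mem _ (ht.mem_toFinset.2 hc), ?_⟩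
  have := dist_triangle G c (H (k c))
  have h1 : dist G c < τ / 2 := hGc
  have h2 := hk c
  linarith

end HalfSpace

/-! ### Convergence of the iterates of a set to the centred ball. -/

section

variable {d : ℕ} {H : ℕ → HalfSpace d}

open HalfSpace

/-- The η-ball around x lies in the iterate of M and the one around y misses it. If y were nearer
the origin, some `H k` from a finite net would gain the ball of radius η/4 around y, against the
smallness of the gains. -/
lemma eventually_norm_le_of_mem_of_notMem (hH : DenseRange H) {K M U : Set (EuclideanSpace ℝ (Fin d))}
    (hM : MeasurableSet M) {R : ℝ} (hR : M ⊆ Metric.ball 0 R) {η : ℝ} (hη : 0 < η)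
    (hKM : Metric.thickening η K ⊆ M) (hMU : Metric.thickening η M ⊆ U) :
    ∀ᶠ n in atTop, ∀ x ∈ polarizeSetIterate H K n, ∀ y ∉ polarizeSetIterate H U n,
      ‖x‖ ≤ ‖y‖ := by
  rcases le_or_gt R 0 with hR0 | hR0
  · refine Eventually.of_forall fun n x hx y _ => ?_
    have := polarizeSetIterate_subset_ball (H := H) hR n (thickening_polarizeSetIterate_subset hKM n
      (Metric.self_subset_thickening hη _ hx))
    rw [mem_ball_zero_iff] at this
    linarith [norm_nonneg x]
  -- Chosen so that η/4 + (R + 1)τ ≤ η/2 puts the small ball inside `H k`, and η/4 + 6(R + 1)τ < η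
  -- puts its mirror image near x.
  set τ : ℝ := η / (12 * (R + 1)) with hτ
  have hτ0 : 0 < τ := by positivity
  have hτR : (R + 1) * τ = η / 12 := by rw [hτ]; field_simp
  obtain ⟨F, hF⟩ := exists_finset_dist_lt hH R hτ0
  have hc : 0 < volume (Metric.ball (0 : EuclideanSpace ℝ (Fin d)) (η / 4)) :=
    Metric.measure_ball_pos _ _ (by positivity)
  have hev : ∀ᶠ n in atTop, ∀ k ∈ F, volume ((H k).gain (polarizeSetIterate H M n)) <
      volume (Metric.ball (0 : EuclideanSpace ℝ (Fin d)) (η / 4)) :=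
    (Filter.eventually_all_finset F).2 fun k _ =>
      (tendsto_volume_gain_polarizeSetIterate hM hR k).eventually_lt_const hc
  filter_upwards [hev] with n hn x hx y hy
  by_contra! hxy
  set M' := polarizeSetIterate H M n
  have hxM : ∀ z, dist z x < η → z ∈ M' := fun z hz =>
    thickening_polarizeSetIterate_subset hKM n (Metric.mem_thickening_iff.2 ⟨x, hx, hz⟩)
  have hyM : ∀ z, dist z y < η → z ∉ M' := fun z hz hzM => hy
    (thickening_polarizeSetIterate_subset hMU n
      (Metric.mem_thickening_iff.2 ⟨z, hzM, by rwa [dist_comm]⟩))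
  have hxR : ‖x‖ < R := by
    simpa using polarizeSetIterate_subset_ball (H := H) hR n (hxM x (by simpa using hη))
  have hdist : η ≤ ‖x - y‖ := by
    by_contra! h
    exact hyM x (by rwa [dist_eq_norm]) (hxM x (by simpa using hη))
  obtain ⟨G, hGx, hGt, hGy⟩ := exists_reflect_eq hxy
  obtain ⟨k, hk, hGk⟩ := hF G (hGt.trans hxR.le)
  have hG1 : dist (G.1 : EuclideanSpace ℝ (Fin d)) (H k).1 < τ :=
    (le_max_left _ _).trans_lt hGk
  have hG2 : dist (G.2 : ℝ) (H k).2 < τ := (le_max_right _ _).trans_lt hGk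
  have hsub : Metric.ball y (η / 4) ⊆ (H k).gain M' := by
    intro z hz
    rw [Metric.mem_ball] at hz
    refine ⟨?_, hyM z (by linarith), hxM _ ?_⟩
    · change inner ℝ z ((H k).1 : EuclideanSpace ℝ (Fin d)) ≤ (H k).2
      have h1 : inner ℝ z ((H k).1 : EuclideanSpace ℝ (Fin d)) =
          inner ℝ (z - y) ((H k).1 : EuclideanSpace ℝ (Fin d)) -
          inner ℝ y ((G.1 : EuclideanSpace ℝ (Fin d)) - (H k).1) +
          inner ℝ y (G.1 : EuclideanSpace ℝ (Fin d)) := by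
        rw [inner_sub_left, inner_sub_right]; ring
      have h2 : inner ℝ (z - y) ((H k).1 : EuclideanSpace ℝ (Fin d)) ≤ η / 4 := by
        refine (real_inner_le_norm _ _).trans ?_
        rw [norm_normal, mul_one, ← dist_eq_norm]
        exact hz.le
      have h3 : -inner ℝ y ((G.1 : EuclideanSpace ℝ (Fin d)) - (H k).1) ≤ R * τ := by
        refine (neg_le_abs _).trans ((abs_real_inner_le_norm _ _).trans ?_)
        rw [← dist_eq_norm]
        exact mul_le_mul (hxy.trans hxR).le hG1.le dist_nonneg hR0.le
      have h4 := (abs_lt.1 (Real.dist_eq (G.2 : ℝ) _ ▸ hG2)).2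
      linarith
    · calc dist ((H k).reflect z) x ≤ dist ((H k).reflect z) ((H k).reflect y) +
            dist ((H k).reflect y) (G.reflect y) := by rw [← hGx]; exact dist_triangle _ _ _
        _ ≤ η / 4 + 2 * ((2 * R + R) * τ + τ) := by
            rw [dist_reflect_reflect, dist_comm ((H k).reflect y)]
            refine add_le_add hz.le ((dist_reflect_reflect_le _ _ _).trans ?_)
            have ht : (0 : ℝ) < G.2 := G.2.2
            gcongr
            · exact (hxy.trans hxR).le
            · exact hGt.trans hxR.le
        _ < η := by nlinarith
  have := measure_mono (μ := volume) hsub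
  rw [Measure.addHaar_ball_center] at this
  exact (hn k hk).not_ge this

/-- The polarization iterates of a set of finite measure converge in measure to the centred ball
of the same measure. -/
theorem tendsto_volume_polarizeSetIterate_sdiff (hH : DenseRange H)
    {A B : Set (EuclideanSpace ℝ (Fin d))} (hA : MeasurableSet A) (hAf : volume A ≠ ∞)
    (hB : MeasurableSet B) (hBA : volume B = volume A)
    (hball : ∀ x ∉ B, ∀ y ∈ B, ‖y‖ < ‖x‖) :
    Tendsto (fun n => volume (polarizeSetIterate H A n \ B) +
      volume (B \ polarizeSetIterate H A n)) atTop (𝓝 0) := by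
  rw [ENNReal.tendsto_nhds_zero]
  intro ε hε
  have hε2 : ε / 2 ≠ 0 := (ENNReal.half_pos hε.ne').ne'
  obtain ⟨K, hKA, hK, hKε⟩ := hA.exists_isCompact_sdiff_lt hAf hε2
  obtain ⟨U, hAU, hU, -, hUε⟩ := hA.exists_isOpen_sdiff_lt hAf hε2
  obtain ⟨δ, hδ, hKU⟩ := hK.exists_thickening_subset_open hU (hKA.trans hAU)
  obtain ⟨R, hR⟩ := (hK.isBounded.thickening (δ := δ / 2)).subset_ball 0
  have hM : MeasurableSet (Metric.thickening (δ / 2) K) := Metric.isOpen_thickening.measurableSet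
  have hMU : Metric.thickening (δ / 2) (Metric.thickening (δ / 2) K) ⊆ U :=
    (Metric.thickening_thickening_subset _ _ _).trans (by rwa [add_halves])
  filter_upwards [eventually_norm_le_of_mem_of_notMem hH hM hR (half_pos hδ) subset_rfl hMU]
    with n hn
  set A' := polarizeSetIterate H A n
  have hA' : MeasurableSet A' := measurableSet_polarizeSetIterate hA n
  have hA'B : volume A' = volume B := (volume_polarizeSetIterate hA n).trans hBA.symm
  -- Equal finite measures make the two differences equal, so it suffices to estimate either one.
  have heq : volume (A' \ B) = volume (B \ A') := by
    have h1 := measure_inter_add_sdiff (μ := volume) A' hB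
    have h2 := measure_inter_add_sdiff (μ := volume) B hA'
    rw [inter_comm, ← hA'B, ← h1, inter_comm] at h2
    exact ((ENNReal.add_right_inj (measure_ne_top_of_subset inter_subset_right
      (by rwa [hA'B, hBA]))).1 h2).symm
  suffices h : volume (A' \ B) ≤ ε / 2 by
    rw [← heq]
    exact (add_le_add h h).trans (ENNReal.add_halves ε).le
  -- Points of the iterate of K are no farther out than points off the iterate of U, so the ball B
  -- contains the former or is contained in the latter.
  by_cases hKB : polarizeSetIterate H K n ⊆ B
  · exact (measure_mono (sdiff_subset_sdiff_right hKB)).trans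
      ((volume_polarizeSetIterate_sdiff_le hA hK.measurableSet hAf n).trans hKε.le)
  · have hBU : B ⊆ polarizeSetIterate H U n := by
      obtain ⟨x, hx, hxB⟩ := not_subset.1 hKB
      intro y hy
      by_contra hyU
      exact (hn x hx y hyU).not_gt (hball x hxB y hy)
    have hUf : volume U ≠ ∞ := by
      rw [← inter_union_sdiff U A]
      exact ((measure_union_le _ _).trans_lt (ENNReal.add_lt_top.2
        ⟨(measure_mono inter_subset_right).trans_lt hAf.lt_top, hUε.trans_le le_top⟩)).ne
    rw [heq]
    exact (measure_mono (sdiff_subset_sdiff_left hBU)).trans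
      ((volume_polarizeSetIterate_sdiff_le hU.measurableSet hA hUf n).trans hUε.le)

end

/-! ### The layer cake formula for differences. -/

section LayerCake

variable {α : Type*} [MeasurableSpace α]

lemma volume_setOf_le_ofReal_lt (x y : ℝ≥0∞) :
    volume.restrict (Ici (0 : ℝ)) {s | y ≤ ENNReal.ofReal s ∧ ENNReal.ofReal s < x} = x - y := by
  have hm : MeasurableSet {s : ℝ | y ≤ ENNReal.ofReal s ∧ ENNReal.ofReal s < x} :=
    (measurableSet_le measurable_const ENNReal.measurable_ofReal).inter
      (measurableSet_lt ENNReal.measurable_ofReal measurable_const)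
  rw [Measure.restrict_apply hm]
  rcases eq_or_ne y ∞ with rfl | hy
  · simp
  rcases eq_or_ne x ∞ with rfl | hx
  · have : {s : ℝ | y ≤ ENNReal.ofReal s ∧ ENNReal.ofReal s < ∞} ∩ Ici 0 = Ici y.toReal := by
      ext s
      simp only [mem_inter_iff, mem_ofPred_eq, ENNReal.ofReal_lt_top, and_true, mem_Ici]
      constructor
      · rintro ⟨h, hs⟩
        exact ENNReal.toReal_le_of_le_ofReal hs h
      · intro h
        exact ⟨ENNReal.le_ofReal_iff_toReal_le hy (ENNReal.toReal_nonneg.trans h) |>.2 h,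
          ENNReal.toReal_nonneg.trans h⟩
    rw [this, Real.volume_Ici, ENNReal.top_sub hy]
  · have : {s : ℝ | y ≤ ENNReal.ofReal s ∧ ENNReal.ofReal s < x} ∩ Ici 0 =
        Ico y.toReal x.toReal := by
      ext s
      simp only [mem_inter_iff, mem_ofPred_eq, mem_Ici, mem_Ico]
      constructor
      · rintro ⟨⟨h, h'⟩, hs⟩
        exact ⟨ENNReal.toReal_le_of_le_ofReal hs h, (ENNReal.ofReal_lt_iff_lt_toReal hs hx).1 h'⟩
      · rintro ⟨h, h'⟩
        have hs : 0 ≤ s := ENNReal.toReal_nonneg.trans h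
        exact ⟨⟨(ENNReal.le_ofReal_iff_toReal_le hy hs).2 h,
          (ENNReal.ofReal_lt_iff_lt_toReal hs hx).2 h'⟩, hs⟩
    rw [this, Real.volume_Ico, ENNReal.ofReal_sub _ ENNReal.toReal_nonneg,
      ENNReal.ofReal_toReal hx, ENNReal.ofReal_toReal hy]

variable {μ : Measure α} [SFinite μ] {f g : α → ℝ≥0∞}

lemma measurableSet_setOf_le_ofReal_lt (hf : Measurable f) (hg : Measurable g) :
    MeasurableSet {z : α × ℝ | g z.1 ≤ ENNReal.ofReal z.2 ∧ ENNReal.ofReal z.2 < f z.1} :=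
  (measurableSet_le (hg.comp measurable_fst) measurable_snd.ennreal_ofReal).inter
    (measurableSet_lt measurable_snd.ennreal_ofReal (hf.comp measurable_fst))

lemma setOf_lt_sdiff_setOf_lt {α : Type*} (f g : α → ℝ≥0∞) (s : ℝ≥0∞) :
    {x | s < f x} \ {x | s < g x} = {x | g x ≤ s ∧ s < f x} := by
  ext x
  simp [and_comm]

lemma measurable_measure_setOf_lt_sdiff (hf : Measurable f) (hg : Measurable g) :
    Measurable fun s : ℝ => μ ({x | ENNReal.ofReal s < f x} \ {x | ENNReal.ofReal s < g x}) := by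
  simp only [setOf_lt_sdiff_setOf_lt]
  exact measurable_measure_prodMk_right (measurableSet_setOf_le_ofReal_lt hf hg)

/-- Tonelli for the region between the graphs, {g ≤ s < f}. -/
lemma lintegral_tsub_eq_lintegral_measure (hf : Measurable f) (hg : Measurable g) :
    ∫⁻ x, (f x - g x) ∂μ = ∫⁻ s in Ici (0 : ℝ),
      μ ({x | ENNReal.ofReal s < f x} \ {x | ENNReal.ofReal s < g x}) := by
  have hS := measurableSet_setOf_le_ofReal_lt hf hg
  have h1 := Measure.prod_apply (μ := μ) (ν := volume.restrict (Ici (0 : ℝ))) hS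
  have h2 := Measure.prod_apply_symm (μ := μ) (ν := volume.restrict (Ici (0 : ℝ))) hS
  rw [h1] at h2
  simp only [setOf_lt_sdiff_setOf_lt]
  refine Eq.trans (lintegral_congr fun x => ?_) h2
  exact (volume_setOf_le_ofReal_lt (f x) (g x)).symm

lemma lintegral_eq_lintegral_measure_setOf_lt (hf : Measurable f) :
    ∫⁻ x, f x ∂μ = ∫⁻ s in Ici (0 : ℝ), μ {x | ENNReal.ofReal s < f x} := by
  simpa using lintegral_tsub_eq_lintegral_measure (μ := μ) hf (measurable_const (a := (0 : ℝ≥0∞)))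

lemma lintegral_absDiff (hf : Measurable f) (hg : Measurable g) :
    ∫⁻ x, absDiff f g x ∂μ = ∫⁻ s in Ici (0 : ℝ),
      (μ ({x | ENNReal.ofReal s < f x} \ {x | ENNReal.ofReal s < g x}) +
        μ ({x | ENNReal.ofReal s < g x} \ {x | ENNReal.ofReal s < f x})) := by
  have hfg : Measurable fun x => f x - g x := hf.sub hg
  simp only [absDiff]
  rw [lintegral_add_left hfg, lintegral_tsub_eq_lintegral_measure hf hg,
    lintegral_tsub_eq_lintegral_measure hg hf,
    lintegral_add_left (measurable_measure_setOf_lt_sdiff hf hg)]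

end LayerCake

/-- Superadditivity of the p-th power, applied to a = (a - b) + b. -/
lemma tsub_rpow_le {a b : ℝ≥0∞} {p : ℝ} (hp : 1 ≤ p) : (a - b) ^ p ≤ a ^ p - b ^ p := by
  have hp0 : 0 < p := zero_lt_one.trans_le hp
  rcases le_or_gt a b with h | h
  · rw [tsub_eq_zero_of_le h, ENNReal.zero_rpow_of_pos hp0]
    exact zero_le
  · refine ENNReal.le_sub_of_add_le_right
      (ENNReal.rpow_lt_top_of_nonneg hp0.le (h.trans_le le_top).ne).ne ?_
    refine (ENNReal.add_rpow_le_rpow_add _ _ hp).trans ?_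
    rw [tsub_add_cancel_of_le h.le]

lemma absDiff_rpow_le {X : Type*} (f g : X → ℝ≥0∞) {p : ℝ} (hp : 1 ≤ p) (x : X) :
    absDiff f g x ^ p ≤ absDiff (fun x => f x ^ p) (fun x => g x ^ p) x := by
  simp only [absDiff]
  rcases le_total (f x) (g x) with h | h
  · rw [tsub_eq_zero_of_le h, zero_add]
    exact (tsub_rpow_le hp).trans le_add_self
  · rw [tsub_eq_zero_of_le h, add_zero]
    exact (tsub_rpow_le hp).trans le_self_add

lemma measurable_absDiff {X : Type*} [MeasurableSpace X] {f g : X → ℝ≥0∞} (hf : Measurable f)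
    (hg : Measurable g) : Measurable (absDiff f g) :=
  (hf.sub hg).add (hg.sub hf)

/-! ### Convergence of the iterates of a function in Lᵖ. -/

section

variable {d : ℕ} {H : ℕ → HalfSpace d} {u v : EuclideanSpace ℝ (Fin d) → ℝ≥0∞}

/-- Polarization only compares values. Applied to p-th powers, this reduces Lᵖ convergence to L¹
convergence. -/
lemma HalfSpace.polarize_comp (H : HalfSpace d) {φ : ℝ≥0∞ → ℝ≥0∞} (hφ : Monotone φ) :
    H.polarize (fun x => φ (u x)) = fun x => φ (H.polarize u x) := by
  ext1 x
  simp only [polarize]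
  split_ifs
  · exact hφ.map_max.symm
  · exact hφ.map_min.symm

lemma polarizeChain_comp {φ : ℝ≥0∞ → ℝ≥0∞} (hφ : Monotone φ) (n : ℕ) :
    polarizeChain H (fun x => φ (u x)) n = fun x => φ (polarizeChain H u n x) := by
  induction n with
  | zero => rfl
  | succ n ih => rw [polarizeChain, ih, HalfSpace.polarize_comp _ hφ, polarizeChain]

lemma polarizationIterate_comp {φ : ℝ≥0∞ → ℝ≥0∞} (hφ : Monotone φ) (n : ℕ) :
    polarizationIterate H (fun x => φ (u x)) n = fun x => φ (polarizationIterate H u n x) := by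
  induction n with
  | zero => rfl
  | succ n ih => rw [polarizationIterate, ih, polarizeChain_comp hφ, polarizationIterate]

lemma measurable_polarizationIterate (hu : Measurable u) (n : ℕ) :
    Measurable (polarizationIterate H u n) := by
  refine measurable_of_Ioi fun s => ?_
  change MeasurableSet {x | s < polarizationIterate H u n x}
  rw [setOf_lt_polarizationIterate]
  exact measurableSet_polarizeSetIterate (measurableSet_lt measurable_const hu) n

lemma lintegral_polarizationIterate (hu : Measurable u) (n : ℕ) :
    ∫⁻ x, polarizationIterate H u n x = ∫⁻ x, u x := by
  rw [lintegral_eq_lintegral_measure_setOf_lt (measurable_polarizationIterate hu n),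
    lintegral_eq_lintegral_measure_setOf_lt hu]
  refine lintegral_congr fun s => ?_
  rw [setOf_lt_polarizationIterate,
    volume_polarizeSetIterate (measurableSet_lt measurable_const hu)]

namespace IsSchwarzSymmetrization

lemma measurable (h : IsSchwarzSymmetrization u v) : Measurable v := by
  refine measurable_of_Ioi fun s => ?_
  obtain ⟨r, hr⟩ := (h s).1
  change MeasurableSet {x | s < v x}
  rw [hr]
  exact measurableSet_lt (by fun_prop) measurable_const

lemma norm_lt_norm (h : IsSchwarzSymmetrization u v) {s : ℝ≥0∞} {x y : EuclideanSpace ℝ (Fin d)}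
    (hx : x ∉ {x | s < v x}) (hy : y ∈ {x | s < v x}) : ‖y‖ < ‖x‖ := by
  obtain ⟨r, hr⟩ := (h s).1
  rw [hr] at hx hy
  simp only [mem_ofPred_eq, not_lt, edist_zero_right] at hx hy
  have := hy.trans_le hx
  rwa [← ofReal_norm, ← ofReal_norm,
    ENNReal.ofReal_lt_ofReal_iff_of_nonneg (norm_nonneg _)] at this

lemma lintegral_eq (h : IsSchwarzSymmetrization u v) (hu : Measurable u) :
    ∫⁻ x, v x = ∫⁻ x, u x := by
  rw [lintegral_eq_lintegral_measure_setOf_lt h.measurable,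
    lintegral_eq_lintegral_measure_setOf_lt hu]
  exact lintegral_congr fun s => (h _).2

lemma rpow (h : IsSchwarzSymmetrization u v) {p : ℝ} (hp : 0 < p) :
    IsSchwarzSymmetrization (fun x => u x ^ p) (fun x => v x ^ p) := by
  intro s
  have key : ∀ w : EuclideanSpace ℝ (Fin d) → ℝ≥0∞,
      {x | s < w x ^ p} = {x | s ^ p⁻¹ < w x} := fun w => by
    ext x
    rw [mem_ofPred_eq, mem_ofPred_eq, ENNReal.rpow_inv_lt_iff hp]
  rw [key, key]
  exact h _

end IsSchwarzSymmetrization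

/-- The polarization iterates of an integrable function converge in mean to its Schwarz
symmetrization. -/
theorem tendsto_lintegral_absDiff_polarizationIterate (hH : DenseRange H) (hu : Measurable u)
    (hfin : ∫⁻ x, u x ≠ ∞) (h : IsSchwarzSymmetrization u v) :
    Tendsto (fun n => ∫⁻ x, absDiff (polarizationIterate H u n) v x) atTop (𝓝 0) := by
  have hun := measurable_polarizationIterate (H := H) hu
  simp only [lintegral_absDiff (hun _) h.measurable]
  have hlevel : ∀ s : ℝ, MeasurableSet {x | ENNReal.ofReal s < u x} := fun s =>
    measurableSet_lt measurable_const hu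
  rw [← lintegral_zero (μ := volume.restrict (Ici (0 : ℝ)))]
  refine tendsto_lintegral_of_dominated_convergence
    (fun s => volume {x | ENNReal.ofReal s < u x} + volume {x | ENNReal.ofReal s < u x})
    (fun n => (measurable_measure_setOf_lt_sdiff (hun n) h.measurable).add
      (measurable_measure_setOf_lt_sdiff h.measurable (hun n)))
    (fun n => Eventually.of_forall fun s => ?_) ?_ ?_
  · refine add_le_add ((measure_mono sdiff_subset).trans ?_) ((measure_mono sdiff_subset).trans ?_)
    · rw [setOf_lt_polarizationIterate, volume_polarizeSetIterate (hlevel s)]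
    · exact (h _).2.le
  · have hm : Measurable fun s : ℝ => volume {x | ENNReal.ofReal s < u x} := by
      simpa using measurable_measure_setOf_lt_sdiff (μ := volume) hu
        (measurable_const (a := (0 : ℝ≥0∞)))
    rw [lintegral_add_left hm, ← lintegral_eq_lintegral_measure_setOf_lt hu]
    exact ENNReal.add_ne_top.2 ⟨hfin, hfin⟩
  -- The level s = 0 is dropped: its superlevel set may have infinite measure, while the others are
  -- finite by Markov's inequality.
  · rw [← restrict_Ioi_eq_restrict_Ici]
    refine (ae_restrict_iff' measurableSet_Ioi).2 (Eventually.of_forall fun s hs => ?_)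
    have hs' := (ENNReal.ofReal_pos.2 hs).ne'
    have hAf : volume {x | ENNReal.ofReal s < u x} ≠ ∞ := by
      have hsub : {x | ENNReal.ofReal s < u x} ⊆ {x | ENNReal.ofReal s ≤ u x} :=
        ofPred_subset_ofPred.2 fun x hx => le_of_lt hx
      exact ((measure_mono hsub).trans_lt ((meas_ge_le_lintegral_div hu.aemeasurable hs'
        ENNReal.ofReal_ne_top).trans_lt (ENNReal.div_lt_top hfin hs'))).ne
    simp only [setOf_lt_polarizationIterate]
    exact tendsto_volume_polarizeSetIterate_sdiff hH (hlevel s) hAf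
      (measurableSet_lt measurable_const h.measurable) (h _).2
      fun x hx y hy => h.norm_lt_norm hx hy

lemma lintegral_absDiff_polarizationIterate_rpow_le (hu : Measurable u)
    (h : IsSchwarzSymmetrization u v) {p : ℝ} (hp : 1 ≤ p) (n : ℕ) :
    ∫⁻ x, absDiff (polarizationIterate H u n) v x ^ p ≤ 2 * ∫⁻ x, u x ^ p := by
  have hp0 : 0 < p := zero_lt_one.trans_le hp
  have hup : Measurable fun x => u x ^ p := hu.pow_const p
  calc ∫⁻ x, absDiff (polarizationIterate H u n) v x ^ p
      ≤ ∫⁻ x, (polarizationIterate H u n x ^ p + v x ^ p) :=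
        lintegral_mono fun x => (absDiff_rpow_le _ _ hp x).trans
          (add_le_add tsub_le_self tsub_le_self)
    _ = 2 * ∫⁻ x, u x ^ p := by
        rw [lintegral_add_right _ (h.measurable.pow_const p), (h.rpow hp0).lintegral_eq hup,
          two_mul, ← lintegral_polarizationIterate (H := H) hup n,
          polarizationIterate_comp (ENNReal.monotone_rpow_of_nonneg hp0.le)]

lemma tendsto_lintegral_absDiff_polarizationIterate_rpow (hH : DenseRange H) (hu : Measurable u)
    (h : IsSchwarzSymmetrization u v) {p : ℝ} (hp : 1 ≤ p) (hfin : ∫⁻ x, u x ^ p ≠ ∞) :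
    Tendsto (fun n => ∫⁻ x, absDiff (polarizationIterate H u n) v x ^ p) atTop (𝓝 0) := by
  have hp0 : 0 < p := zero_lt_one.trans_le hp
  have := tendsto_lintegral_absDiff_polarizationIterate hH (hu.pow_const p) hfin (h.rpow hp0)
  refine tendsto_of_tendsto_of_tendsto_of_le_of_le tendsto_const_nhds this (fun _ => zero_le)
    fun n => lintegral_mono fun x => ?_
  rw [polarizationIterate_comp (ENNReal.monotone_rpow_of_nonneg hp0.le)]
  exact absDiff_rpow_le _ _ hp x

end

lemma eLpNorm_ofReal_eq {α : Type*} [MeasurableSpace α] {μ : Measure α} (f : α → ℝ≥0∞) {p : ℝ}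
    (hp : 0 < p) : eLpNorm f (ENNReal.ofReal p) μ = (∫⁻ x, f x ^ p ∂μ) ^ p⁻¹ := by
  rw [eLpNorm_eq_lintegral_rpow_enorm_toReal (ENNReal.ofReal_pos.2 hp).ne' ENNReal.ofReal_ne_top,
    ENNReal.toReal_ofReal hp.le, one_div]
  simp

lemma ENNReal.tendsto_const_rpow (x : ℝ≥0∞) {ι : Type*} {l : Filter ι} {p : ι → ℝ} {q : ℝ}
    (hq : 0 < q) (h : Tendsto p l (𝓝 q)) : Tendsto (fun i => x ^ p i) l (𝓝 (x ^ q)) := by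
  have hev : ∀ᶠ i in l, 0 < p i := h.eventually_const_lt hq
  induction x with
  | top =>
    rw [ENNReal.top_rpow_of_pos hq]
    refine tendsto_const_nhds.congr' ?_
    filter_upwards [hev] with i hi
    rw [ENNReal.top_rpow_of_pos hi]
  | coe x =>
    have h1 : Tendsto (fun i => x ^ p i) l (𝓝 (x ^ q)) :=
      tendsto_const_nhds.nnrpow h (Or.inr hq)
    rw [← ENNReal.coe_rpow_of_nonneg _ hq.le]
    refine (ENNReal.tendsto_coe.2 h1).congr' ?_
    filter_upwards [hev] with i hi
    rw [ENNReal.coe_rpow_of_nonneg _ hi.le]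

/-! ### From Lᵖ convergence to the grand Lebesgue norm. -/

section

variable {α : Type*} [MeasurableSpace α] {μ : Measure α} {u : α → ℝ≥0∞}

/-- Some set {u ≥ δ} has positive measure m, and δ m^(1/p) ≥ δ min(m, 1) for p ≥ 1. This will bound
the weight away from zero. -/
lemma exists_pos_le_eLpNorm (hu : Measurable u) (h0 : ¬ u =ᵐ[μ] 0) :
    ∃ c : ℝ≥0∞, c ≠ 0 ∧ ∀ p : ℝ, 1 ≤ p → c ≤ eLpNorm u (ENNReal.ofReal p) μ := by
  have hpos : μ (⋃ k : ℕ, {x | ((k : ℝ≥0∞))⁻¹ ≤ u x}) ≠ 0 := by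
    refine fun h => h0 (measure_mono_null (fun x hx => ?_) h)
    obtain ⟨k, hk⟩ := ENNReal.exists_inv_nat_lt (show u x ≠ 0 from hx)
    exact mem_iUnion.2 ⟨k, hk.le⟩
  obtain ⟨k, hk⟩ := exists_measure_pos_of_not_measure_iUnion_null hpos
  set δ : ℝ≥0∞ := (k : ℝ≥0∞)⁻¹ with hδ
  set m := μ {x | δ ≤ u x} with hm
  refine ⟨δ * min m 1, mul_ne_zero (ENNReal.inv_ne_zero.2 (ENNReal.natCast_ne_top k))
    (lt_min hk one_pos).ne', fun p hp => ?_⟩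
  have hp0 : 0 < p := zero_lt_one.trans_le hp
  rw [eLpNorm_ofReal_eq u hp0, ENNReal.le_rpow_inv_iff hp0, ENNReal.mul_rpow_of_nonneg _ _ hp0.le]
  calc δ ^ p * min m 1 ^ p ≤ δ ^ p * m := by
        gcongr
        exact (ENNReal.rpow_le_self_of_le_one (min_le_right _ _) hp).trans (min_le_left _ _)
    _ ≤ ∫⁻ x, u x ^ p ∂μ := by
        refine le_trans ?_ (mul_meas_ge_le_lintegral (hu.pow_const p) (δ ^ p))
        gcongr
        exact measure_mono (ofPred_subset_ofPred.2 fun x hx => ENNReal.rpow_le_rpow hx hp0.le)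

/-- Fatou's lemma. It is needed for limits q of exponents that may be end points of the exponent
interval, where the norm of G says nothing directly. -/
lemma lintegral_rpow_ne_top_of_tendsto (hu : Measurable u) {p : ℕ → ℝ} {q r : ℝ} (hq : 0 < q)
    (hp : ∀ k, 0 < p k) (hpr : ∀ k, p k ≤ r) (h : Tendsto p atTop (𝓝 q)) {D : ℝ≥0∞} (hD : D ≠ ∞)
    (hle : ∀ k, eLpNorm u (ENNReal.ofReal (p k)) μ ≤ D) : ∫⁻ x, u x ^ q ∂μ ≠ ∞ := by
  have hr : 0 ≤ r := (hp 0).le.trans (hpr 0)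
  have hbound : ∀ k, ∫⁻ x, u x ^ p k ∂μ ≤ max D 1 ^ r := fun k => by
    have := hle k
    rw [eLpNorm_ofReal_eq u (hp k), ENNReal.rpow_inv_le_iff (hp k)] at this
    exact this.trans ((ENNReal.rpow_le_rpow (le_max_left D 1) (hp k).le).trans
      (ENNReal.rpow_le_rpow_of_exponent_le (le_max_right D 1) (hpr k)))
  refine ((?_ : ∫⁻ x, u x ^ q ∂μ ≤ max D 1 ^ r).trans_lt
    (ENNReal.rpow_lt_top_of_nonneg hr (max_lt hD.lt_top ENNReal.one_lt_top).ne)).ne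
  calc ∫⁻ x, u x ^ q ∂μ = ∫⁻ x, liminf (fun k => u x ^ p k) atTop ∂μ :=
        lintegral_congr fun x => ((ENNReal.tendsto_const_rpow (u x) hq h).liminf_eq).symm
    _ ≤ liminf (fun k => ∫⁻ x, u x ^ p k ∂μ) atTop :=
        lintegral_liminf_le fun k => hu.pow_const _
    _ ≤ max D 1 ^ r := (liminf_le_liminf (Eventually.of_forall hbound)).trans
        (liminf_const _).le

lemma lintegral_rpow_le_add (f : α → ℝ≥0∞) (hf : Measurable f) {p q r : ℝ} (hqp : q ≤ p)
    (hpr : p ≤ r) : ∫⁻ x, f x ^ p ∂μ ≤ ∫⁻ x, f x ^ q ∂μ + ∫⁻ x, f x ^ r ∂μ := by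
  rw [← lintegral_add_left (hf.pow_const q)]
  refine lintegral_mono fun x => ?_
  rcases le_total (f x) 1 with h | h
  · exact (ENNReal.rpow_le_rpow_of_exponent_ge h hqp).trans le_self_add
  · exact (ENNReal.rpow_le_rpow_of_exponent_le h hpr).trans le_add_self

lemma one_le_of_mem_expInterval {a : ℝ} {b : EReal} (ha : 1 ≤ a) {p : ℝ}
    (hp : p ∈ expInterval a b) : 1 ≤ p := ha.trans hp.1.le

/-- A sequence that is dominated by `u` in every `Lᵖ` and that tends to zero in every `Lᵖ`
containing `u` tends to zero in the norm of `G(ν)` when `u ∈ Gᵒ(ν)`. -/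
theorem memGo_and_tendsto_gNorm {a : ℝ} {b : EReal} (ha : 1 ≤ a) {ν : ℝ → ℝ}
    (hν : IsWeight a b ν) (hνb : b = ⊤ → Tendsto ν atTop atTop) (hu : MemGo μ a b ν u)
    {w : ℕ → α → ℝ≥0∞} (hw : ∀ n, Measurable (w n))
    (hle : ∀ n, ∀ p : ℝ, 1 ≤ p → ∫⁻ x, w n x ^ p ∂μ ≤ 2 * ∫⁻ x, u x ^ p ∂μ)
    (hlim : ∀ p : ℝ, 1 ≤ p → ∫⁻ x, u x ^ p ∂μ ≠ ∞ →
      Tendsto (fun n => ∫⁻ x, w n x ^ p ∂μ) atTop (𝓝 0)) :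
    (∀ n, MemGo μ a b ν (w n)) ∧ Tendsto (fun n => gNorm μ a b ν (w n)) atTop (𝓝 0) := by
  obtain ⟨⟨hum, hufin⟩, huo⟩ := hu
  set C := gNorm μ a b ν u with hC
  have hnorm : ∀ n, ∀ p : ℝ, 1 ≤ p →
      eLpNorm (w n) (ENNReal.ofReal p) μ ≤ 2 * eLpNorm u (ENNReal.ofReal p) μ := fun n p hp => by
    have hp0 : 0 < p := zero_lt_one.trans_le hp
    rw [eLpNorm_ofReal_eq _ hp0, eLpNorm_ofReal_eq _ hp0, ENNReal.rpow_inv_le_iff hp0,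
      ENNReal.mul_rpow_of_nonneg _ _ hp0.le, ENNReal.rpow_inv_rpow hp0.ne']
    refine (hle n p hp).trans ?_
    gcongr
    exact ENNReal.le_rpow_self_of_one_le one_le_two hp
  have hquot : ∀ n, ∀ p ∈ expInterval a b, gQuot μ ν (w n) p ≤ 2 * gQuot μ ν u p :=
    fun n p hp => by
      rw [gQuot, gQuot, ← mul_div_assoc]
      exact ENNReal.div_le_div_right (hnorm n p (one_le_of_mem_expInterval ha hp)) _
  have hquotC : ∀ p ∈ expInterval a b, gQuot μ ν u p ≤ C := fun p hp =>
    le_iSup₂ (f := fun p _ => gQuot μ ν u p) p hp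
  have huC : ∀ p ∈ expInterval a b,
      eLpNorm u (ENNReal.ofReal p) μ ≤ C * ENNReal.ofReal (ν p) := fun p hp =>
    (ENNReal.div_le_iff (ENNReal.ofReal_pos.2 (hν.pos p hp)).ne' ENNReal.ofReal_ne_top).1
      (hquotC p hp)
  constructor
  · refine fun n => ⟨⟨hw n, ?_⟩, ?_⟩
    · refine (iSup₂_le fun p hp => (hquot n p hp).trans
        (mul_le_mul_right (hquotC p hp) 2) : gNorm μ a b ν (w n) ≤ 2 * C).trans_lt ?_
      exact ENNReal.mul_lt_top ENNReal.ofNat_lt_top hufin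
    · have h2 := ENNReal.Tendsto.const_mul (a := 2) huo (Or.inr ENNReal.ofNat_ne_top)
      rw [mul_zero] at h2
      refine tendsto_of_tendsto_of_tendsto_of_le_of_le' tendsto_const_nhds h2
        (Eventually.of_forall fun _ => zero_le) ?_
      exact eventually_inf_principal.2 (Eventually.of_forall fun p hp => hquot n p hp)
  by_cases h0 : u =ᵐ[μ] 0
  · refine tendsto_const_nhds.congr fun n => ?_
    symm
    refine le_antisymm (iSup₂_le fun p hp => (hquot n p hp).trans ?_) zero_le
    rw [gQuot, eLpNorm_congr_ae h0, eLpNorm_zero, ENNReal.zero_div, mul_zero]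
  obtain ⟨c, hc0, hc⟩ := exists_pos_le_eLpNorm hum h0
  rw [ENNReal.tendsto_nhds_zero]
  intro ε hε
  have hev := huo.eventually (ge_mem_nhds (ENNReal.half_pos hε.ne'))
  rw [weightFilter, eventually_inf_principal, eventually_comap] at hev
  obtain ⟨T, hT⟩ := eventually_atTop.1 hev
  -- Off P the weight is so large that the bound by u suffices for every n; only P requires
  -- convergence.
  set P := {p ∈ expInterval a b | ν p < T} with hP
  have hbig : ∀ n, ∀ p ∈ expInterval a b, p ∉ P → gQuot μ ν (w n) p ≤ ε := by
    intro n p hp hpP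
    have hpT : T ≤ ν p := not_lt.1 fun h => hpP ⟨hp, h⟩
    calc gQuot μ ν (w n) p ≤ 2 * gQuot μ ν u p := hquot n p hp
      _ ≤ 2 * (ε / 2) := mul_le_mul_right (hT _ hpT p rfl hp) 2
      _ = ε := ENNReal.mul_div_cancel two_ne_zero ENNReal.ofNat_ne_top
  rcases P.eq_empty_or_nonempty with hPe | hPne
  · exact Eventually.of_forall fun n => iSup₂_le fun p hp => hbig n p hp (by simp [hPe])
  have hPbelow : BddBelow P := ⟨a, fun p hp => hp.1.1.le⟩
  have hPabove : BddAbove P := by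
    induction b with
    | bot => exact ⟨0, fun p hp => absurd hp.1.2 not_lt_bot⟩
    | coe b => exact ⟨b, fun p hp => (EReal.coe_lt_coe_iff.1 hp.1.2).le⟩
    | top =>
      obtain ⟨B, hB⟩ := eventually_atTop.1 ((hνb rfl).eventually_ge_atTop T)
      exact ⟨B, fun p hp => le_of_not_ge fun h => (hB p h).not_gt hp.2⟩
  have hP1 : ∀ p ∈ P, 1 ≤ p := fun p hp => one_le_of_mem_expInterval ha hp.1
  obtain ⟨p₀, hp₀⟩ := hPne
  have hα1 : 1 ≤ sInf P := le_csInf ⟨p₀, hp₀⟩ hP1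
  have hβ1 : 1 ≤ sSup P := (hP1 p₀ hp₀).trans (le_csSup hPabove hp₀)
  have hfin : ∀ q : ℝ, 1 ≤ q → (∃ p : ℕ → ℝ, Tendsto p atTop (𝓝 q) ∧ ∀ k, p k ∈ P) →
      ∫⁻ x, u x ^ q ∂μ ≠ ∞ := by
    rintro q hq ⟨p, hpq, hpP⟩
    refine lintegral_rpow_ne_top_of_tendsto hum (zero_lt_one.trans_le hq)
      (fun k => zero_lt_one.trans_le (hP1 _ (hpP k))) (fun k => le_csSup hPabove (hpP k)) hpq
      (D := C * ENNReal.ofReal T) (ENNReal.mul_ne_top hufin.ne ENNReal.ofReal_ne_top) fun k => ?_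
    refine (huC _ (hpP k).1).trans ?_
    gcongr
    exact (hpP k).2.le
  have hαfin : ∫⁻ x, u x ^ sInf P ∂μ ≠ ∞ := by
    obtain ⟨p, -, hp, hpP⟩ := exists_seq_tendsto_sInf ⟨p₀, hp₀⟩ hPbelow
    exact hfin _ hα1 ⟨p, hp, hpP⟩
  have hβfin : ∫⁻ x, u x ^ sSup P ∂μ ≠ ∞ := by
    obtain ⟨p, -, hp, hpP⟩ := exists_seq_tendsto_sSup ⟨p₀, hp₀⟩ hPabove
    exact hfin _ hβ1 ⟨p, hp, hpP⟩
  have hS := (hlim _ hα1 hαfin).add (hlim _ hβ1 hβfin)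
  rw [add_zero] at hS
  have hβ0 : 0 < sSup P := zero_lt_one.trans_le hβ1
  -- The quotient c/C bounds ν from below: c ≤ |u|_p ≤ C ν(p).
  have hSβ : Tendsto (fun n => (∫⁻ x, w n x ^ sInf P ∂μ + ∫⁻ x, w n x ^ sSup P ∂μ) ^ (sSup P)⁻¹ /
      (c / C)) atTop (𝓝 0) := by
    have h1 := (ENNReal.continuous_rpow_const (y := (sSup P)⁻¹)).tendsto 0 |>.comp hS
    rw [ENNReal.zero_rpow_of_pos (inv_pos.2 hβ0)] at h1
    have h2 := ENNReal.Tendsto.div_const h1 (b := c / C)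
      (Or.inr (ENNReal.div_pos hc0 hufin.ne).ne')
    rwa [ENNReal.zero_div] at h2
  filter_upwards [hS.eventually (ge_mem_nhds one_pos), hSβ.eventually (ge_mem_nhds hε)]
    with n hn1 hnε
  refine iSup₂_le fun p hp => ?_
  by_cases hpP : p ∈ P
  · refine le_trans ?_ hnε
    have hp1 := hP1 p hpP
    have hp0 : 0 < p := zero_lt_one.trans_le hp1
    have hpβ : p ≤ sSup P := le_csSup hPabove hpP
    rw [gQuot]
    refine ENNReal.div_le_div ?_ ?_
    · rw [eLpNorm_ofReal_eq _ hp0]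
      refine (ENNReal.rpow_le_rpow (lintegral_rpow_le_add _ (hw n) (csInf_le hPbelow hpP) hpβ)
        (inv_nonneg.2 hp0.le)).trans ?_
      -- The sum of the two end integrals is at most 1, so the smallest exponent 1/`sSup P` gives a
      -- bound uniform over P.
      exact ENNReal.rpow_le_rpow_of_exponent_ge hn1 (inv_anti₀ hp0 hpβ)
    · exact ENNReal.div_le_of_le_mul' ((hc p hp1).trans (huC p hp))
  · exact hbig n p hp hpP

/-- Since |u|_p ≤ ‖u‖ ψ(p), the quotient for ν is at most ‖u‖ ψ(p)/ν(p), where ‖u‖ is the norm in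
G(ψ). -/
lemma MemG.memGo_of_muchGreater {a : ℝ} {b : EReal} {ψ ν : ℝ → ℝ} (hψ : IsWeight a b ψ)
    (hν : IsWeight a b ν) (hu : MemG μ a b ψ u) (h : MuchGreater a b ν ψ)
    (hC : ∃ C : ℝ, ∀ p ∈ expInterval a b, ψ p ≤ C * ν p) : MemGo μ a b ν u := by
  obtain ⟨hum, hufin⟩ := hu
  obtain ⟨C, hC⟩ := hC
  have key : ∀ p ∈ expInterval a b,
      gQuot μ ν u p ≤ gNorm μ a b ψ u * ENNReal.ofReal (ψ p / ν p) := fun p hp => by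
    have hψp := ENNReal.ofReal_pos.2 (hψ.pos p hp)
    have h1 : gQuot μ ψ u p ≤ gNorm μ a b ψ u := le_iSup₂ (f := fun p _ => gQuot μ ψ u p) p hp
    rw [gQuot, ENNReal.div_le_iff hψp.ne' ENNReal.ofReal_ne_top] at h1
    rw [gQuot, ENNReal.ofReal_div_of_pos (hν.pos p hp), ← mul_div_assoc]
    exact ENNReal.div_le_div_right h1 _
  refine ⟨⟨hum, ?_⟩, ?_⟩
  · refine (iSup₂_le fun p hp => (key p hp).trans ?_ : gNorm μ a b ν u ≤
      gNorm μ a b ψ u * ENNReal.ofReal C).trans_lt (ENNReal.mul_lt_top hufin ENNReal.ofReal_lt_top)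
    gcongr
    exact (div_le_iff₀ (hν.pos p hp)).2 (hC p hp)
  · have h1 := ENNReal.Tendsto.const_mul (a := gNorm μ a b ψ u)
      (ENNReal.tendsto_ofReal h) (Or.inr hufin.ne)
    rw [ENNReal.ofReal_zero, mul_zero] at h1
    exact tendsto_of_tendsto_of_tendsto_of_le_of_le' tendsto_const_nhds h1
      (Eventually.of_forall fun _ => zero_le)
      (eventually_inf_principal.2 (Eventually.of_forall key))

end

theorem theorem3 (d : ℕ) (hd : 0 < d) (a : ℝ) (b : EReal) (ha : 1 ≤ a) (hab : (a : EReal) < b)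
    (ψ : ℝ → ℝ) (hψ : IsWeight a b ψ)
    (u : EuclideanSpace ℝ (Fin d) → ℝ≥0∞) (hu : MemG volume a b ψ u)
    (ustar : EuclideanSpace ℝ (Fin d) → ℝ≥0∞) (hustar : IsSchwarzSymmetrization u ustar)
    (H : ℕ → HalfSpace d) (hH : DenseRange H) :
    (∀ ν : ℝ → ℝ, IsWeight a b ν → MuchGreater a b ν ψ →
      (∃ C : ℝ, ∀ p ∈ expInterval a b, ψ p ≤ C * ν p) →
      (b = ⊤ → Tendsto ν atTop atTop) →
      (∀ n, MemG volume a b ν (absDiff (polarizationIterate H u n) ustar)) ∧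
      Tendsto (fun n => gNorm volume a b ν (absDiff (polarizationIterate H u n) ustar))
        atTop (𝓝 0)) ∧
    (MemGo volume a b ψ u → (b = ⊤ → Tendsto ψ atTop atTop) →
      (∀ n, MemGo volume a b ψ (absDiff (polarizationIterate H u n) ustar)) ∧
      Tendsto (fun n => gNorm volume a b ψ (absDiff (polarizationIterate H u n) ustar))
        atTop (𝓝 0)) := by
  have main : ∀ ν : ℝ → ℝ, IsWeight a b ν → MemGo volume a b ν u →
      (b = ⊤ → Tendsto ν atTop atTop) →
      (∀ n, MemGo volume a b ν (absDiff (polarizationIterate H u n) ustar)) ∧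
      Tendsto (fun n => gNorm volume a b ν (absDiff (polarizationIterate H u n) ustar))
        atTop (𝓝 0) := fun ν hν huν hνb =>
    memGo_and_tendsto_gNorm ha hν hνb huν
      (fun n => measurable_absDiff (measurable_polarizationIterate hu.1 n) hustar.measurable)
      (fun n p hp => lintegral_absDiff_polarizationIterate_rpow_le hu.1 hustar hp n)
      (fun p hp hfin => tendsto_lintegral_absDiff_polarizationIterate_rpow hH hu.1 hustar hp hfin)
  refine ⟨fun ν hν hνψ hC hνb => ?_, fun huo hψb => main ψ hψ huo hψb⟩
  have h := main ν hν (hu.memGo_of_muchGreater hψ hν hνψ hC) hνb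
  exact ⟨fun n => (h.1 n).1, h.2⟩
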